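/- Let $M$ be a smooth manifold, let $A\to M$ be a smooth real vector bundle of finite rank, and let $(A,\mu)$ be a Lie algebroid, with bracket $[\,,]^\mu$ on $\Gamma A$ and anchor $\rho$. Let $E=A\oplus A^*$ with the canonical form $\langle X+\xi,Y+\eta\rangle=\langle\xi,Y\rangle+\langle\eta,X\rangle$. Let $\mathcal A=\bigoplus_n\mathcal A^n$ be the graded algebra of functions on the minimal symplectic realization $T^*[2]A[1]$ of $E$, with its canonical Poisson bracket $\{\,,\}$ of degree $-2$, so that $\mathcal A^0=C^\infty(M)$, $\mathcal A^1=\Gamma E$ and $\{u,v\}=\langle u,v\rangle$ for $u,v\in\Gamma E$. A Courant algebroid structure on $(E,\langle\,,\rangle)$ is an element $\Theta\in\mathcal A^3$ with $\{\Theta,\Theta\}=0$; its anchor and Dorfman bracket are $\rho_\Theta(u)f=\{\{u,\Theta\},f\}$ and $[u,v]_\Theta=\{\{u,\Theta\},v\}$. Write $\mu\in\mathcal A^3$ also for the element whose anchor is $X+\xi\mapsto\rho(X)$ and whose Dorfman bracket is $[X+\xi,Y+\eta]=[X,Y]^\mu+\mathcal L^\mu_X\eta-i_Y\mathrm d_\mu\xi$;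 it satisfies $\{\mu,\mu\}=0$. Similarly, a Lie algebroid structure on $A^*$ defines an element $\gamma\in\mathcal A^3$, with the roles of $A$ and $A^*$ exchanged. The pair $((A,\mu),(A^*,\gamma))$ is a Lie bialgebroid if $\{\mu,\mu\}=\{\mu,\gamma\}=\{\gamma,\gamma\}=0$; its double is the Courant algebroid $(E,\langle\,,\rangle,\mu+\gamma)$. The Lie bialgebroid is called trivial if $\gamma=0$, i.e. if $A^*$ has zero bracket and zero anchor. A skew-symmetric endomorphism $\mathcal N$ of $E$ (that is, $\langle\mathcal Nu,v\rangle+\langle u,\mathcal Nv\rangle=0$) corresponds to the unique $\widetilde{\mathcal N}\in\mathcal A^2$ such that $\mathcal N(u)=\{u,\widetilde{\mathcal N}\}$ for all $u\in\Gamma E$. It is a weak deforming tensor for a Courant algebroid structure $\Theta$ if $\{\{\widetilde{\mathcal N},\Theta\},\widetilde{\mathcal N}\}$ is a cocycle of $\mathrm d_\Theta=\{\Theta,\cdot\}$, i.e. $\{\Theta,\{\{\widetilde{\mathcal N},\Theta\},\widetilde{\mathcal N}\}\}=0$. **Theorem.** Let $N:A\to A$ be a vector bundle endomorphism which is a Nijenhuis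 tensor for $(A,\mu)$, i.e. $[NX,NY]^\mu=N[X,Y]^\mu_N$ for all $X,Y\in\Gamma A$, where $[X,Y]^\mu_N=[NX,Y]^\mu+[X,NY]^\mu-N[X,Y]^\mu$. (No condition is imposed on $N^2$.) Then $\mathcal N=\begin{pmatrix}N&0\\0&-{}^tN\end{pmatrix}$ is a weak deforming tensor for the Courant algebroid $(A\oplus A^*,\mu)$, and $\{\widetilde{\mathcal N},\mu\}$ is a Courant algebroid structure on $A\oplus A^*$. Moreover, the bracket $[\,,]^\mu_N$ and the anchor $\rho\circ N$ define a Lie algebroid structure $\mu_N$ on $A$, $((A,\mu_N),(A^*,0))$ is a trivial Lie bialgebroid, and $\{\widetilde{\mathcal N},\mu\}$ is the Courant algebroid structure of its double. -/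

import Mathlib

open scoped Manifold ContDiff Bundle

/-! ## The graded Poisson algebra of a module with a symmetric bilinear form -/

namespace CourantNijenhuis

section GradedPoisson

variable {R E : Type*} [CommRing R] [Algebra ℝ R] [AddCommGroup E] [Module R E]

/-! Below, `R` is the algebra of smooth functions on a manifold, `E` is the module of sections of a
vector bundle with a nondegenerate fibrewise symmetric bilinear form `B`, and `𝒜 = ⨁ 𝒜ⁿ` is the
graded algebra of functions on the minimal symplectic realization of the bundle, with its Poisson
bracket of degree `-2`.  Locally `𝒜` consists of the polynomials in coordinates `τᵃ` (odd, of degree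
`1`) and `pᵢ` (of degree `2`) whose coefficients are functions of the base coordinates `qⁱ`, and
`{qⁱ, pⱼ} = δⁱⱼ`, `{τᵃ, τᵇ} = gᵃᵇ`; thus `𝒜⁰ = R` and `𝒜¹ = E`.

Since the Poisson bracket is nondegenerate, `a ∈ 𝒜` is determined by all its iterated brackets
`{… {{a, x₁}, x₂} …, xₖ} ∈ 𝒜⁰ = R` with elements `xᵢ` of `𝒜⁰` and `𝒜¹`.  We represent `a` by the
function `[x₁, …, xₖ] ↦` (degree-`0` part of `{… {{a, x₁}, x₂} …, xₖ}`) on words in the alphabet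
`E ⊕ R`.  The functions on words which arise from the elements of `𝒜ⁿ` are exactly those
satisfying `IsOfDegree B n` below: these conditions are the Jacobi identity for the bracket with
two letters (where `{u, v} = B u v`, `{u, f} = 0`, `{f, g} = 0`), the fact that `{a, ·}` is
`R`-linear on `E` when `a ∈ 𝒜¹`, and the fact that `{a, ·}` is a derivation of `R` (a vector field)
when `a ∈ 𝒜²`. -/

/-- Functions on words in the alphabet `E ⊕ R`. -/
abbrev WordFunction (R E : Type*) := List (E ⊕ R) → R

/-- The degree of a word: letters in `E` have degree `1`, letters in `R` have degree `2`. -/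
def wordDegree : List (E ⊕ R) → ℕ
  | [] => 0
  | Sum.inl _ :: w => wordDegree w + 1
  | Sum.inr _ :: w => wordDegree w + 2

/-- The word function of `{a, x}`, where the letter `x` is an element of `𝒜⁰` or of `𝒜¹`. -/
def contract (x : E ⊕ R) (a : WordFunction R E) : WordFunction R E := fun w => a (x :: w)

/-- The parity automorphism, `a ↦ (-1)ⁿ a` for `a ∈ 𝒜ⁿ`. -/
def parityFlip (a : WordFunction R E) : WordFunction R E := fun w => (-1) ^ wordDegree w * a w

/-- `a` represents an element of `𝒜ⁿ`. -/
structure IsOfDegree (B : LinearMap.BilinForm R E) (n : ℕ) (a : WordFunction R E) : Prop where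
  support : ∀ w, wordDegree w ≠ n → a w = 0
  swap_sections : ∀ w u v w', a (w ++ Sum.inl u :: Sum.inl v :: w') +
    a (w ++ Sum.inl v :: Sum.inl u :: w') = a (w ++ Sum.inr (B u v) :: w')
  swap_section_function : ∀ w u f w', a (w ++ Sum.inl u :: Sum.inr f :: w') =
    a (w ++ Sum.inr f :: Sum.inl u :: w')
  swap_functions : ∀ w f g w', a (w ++ Sum.inr f :: Sum.inr g :: w') =
    a (w ++ Sum.inr g :: Sum.inr f :: w')
  last_section : ∀ w, ∃ φ : E →ₗ[R] R, ∀ u, a (w ++ [Sum.inl u]) = φ u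
  last_function : ∀ w, ∃ D : Derivation ℝ R R, ∀ f, a (w ++ [Sum.inr f]) = D f

open Classical in
/-- The inverse of `E → E*` defined by the form `B`: the section representing the linear form `φ`
(which exists and is unique for the sections of a bundle with a nondegenerate form). -/
noncomputable def sharp (B : LinearMap.BilinForm R E) (φ : E → R) : E :=
  if h : ∃ e, ∀ u, B e u = φ u then h.choose else 0

/-- The value at a word of the Poisson bracket `{a, b}`.

Empty word: the degree-`0` part of `{a, b}` is the sum of the contributions of the components of
`a` and `b` of degrees `(1, 1)`, `(2, 0)`, and `(0, 2)`, in this order.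

Nonempty word: the Jacobi identity `{{a, b}, x} = {a, {b, x}} + (-1) ^ (|b| |x|) {{a, x}, b}`. -/
noncomputable def bracketAt (B : LinearMap.BilinForm R E) :
    List (E ⊕ R) → WordFunction R E → WordFunction R E → R
  | [], a, b =>
      B (sharp B fun u => a [Sum.inl u]) (sharp B fun u => b [Sum.inl u])
        + a [Sum.inr (b [])] - b [Sum.inr (a [])]
  | Sum.inl u :: w, a, b =>
      bracketAt B w a (contract (Sum.inl u) b)
        + bracketAt B w (contract (Sum.inl u) a) (parityFlip b)
  | Sum.inr f :: w, a, b =>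
      bracketAt B w a (contract (Sum.inr f) b) + bracketAt B w (contract (Sum.inr f) a) b

/-- The Poisson bracket of degree `-2` of `𝒜`. -/
noncomputable def poisson (B : LinearMap.BilinForm R E) (a b : WordFunction R E) :
    WordFunction R E := fun w => bracketAt B w a b

/-- A Courant algebroid structure: `Θ ∈ 𝒜³` with `{Θ, Θ} = 0`. The anchor and the Dorfman bracket
are the derived brackets: `Θ [u, f] = {{u, Θ}, f} = ρ(u) f` and `Θ [u, v, w] = ⟨[u, v], w⟩`,
where `[u, v] = {{u, Θ}, v}`. -/
def IsCourantStructure (B : LinearMap.BilinForm R E) (Θ : WordFunction R E) : Prop :=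
  IsOfDegree B 3 Θ ∧ poisson B Θ Θ = 0

/-- Infinitesimally orthogonal endomorphisms. -/
def IsSkewEndomorphism (B : LinearMap.BilinForm R E) (𝒩 : E →ₗ[R] E) : Prop :=
  ∀ u v, B (𝒩 u) v + B u (𝒩 v) = 0

/-- The element `𝒩~` of `𝒜²` attached to a skew endomorphism `𝒩`, characterized by
`𝒩 u = {u, 𝒩~}`; so `{{𝒩~, u}, v} = - {𝒩 u, v} = - ⟨𝒩 u, v⟩` and `{𝒩~, f} = 0`. -/
def tilde (B : LinearMap.BilinForm R E) (𝒩 : E →ₗ[R] E) : WordFunction R E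
  | [Sum.inl u, Sum.inl v] => - B (𝒩 u) v
  | _ => 0

/-- `𝒩` is a weak deforming tensor of the Courant algebroid `(E, B, Θ)`: a skew endomorphism such
that `{{𝒩~, Θ}, 𝒩~}` is a cocycle of `d_Θ = {Θ, ·}`. -/
def IsWeakDeforming (B : LinearMap.BilinForm R E) (Θ : WordFunction R E) (𝒩 : E →ₗ[R] E) : Prop :=
  IsCourantStructure B Θ ∧ IsSkewEndomorphism B 𝒩 ∧
    poisson B Θ (poisson B (poisson B (tilde B 𝒩) Θ) (tilde B 𝒩)) = 0

end GradedPoisson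

/-! ## Lie algebroids on the level of sections, and the double of a Lie bialgebroid -/

section Double

variable {R L : Type*} [CommRing R] [Algebra ℝ R] [AddCommGroup L] [Module R L]

/-- A Lie algebroid structure on a vector bundle over `M`, in terms of the module `L` of sections
over `R = C^∞(M)`; the anchor is the induced map from sections to vector fields.
(`ℝ`-bilinearity of the bracket is a case of the Leibniz rule.) -/
structure LieStructure (R L : Type*) [CommRing R] [Algebra ℝ R] [AddCommGroup L] [Module R L] where
  bracket : L →+ L →+ L
  anchor : L →ₗ[R] Derivation ℝ R R
  bracket_self : ∀ X, bracket X X = 0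
  jacobi : ∀ X Y Z,
    bracket X (bracket Y Z) = bracket (bracket X Y) Z + bracket Y (bracket X Z)
  leibniz : ∀ X (f : R) Y, bracket X (f • Y) = f • bracket X Y + anchor X f • Y
  anchor_bracket : ∀ X Y f,
    anchor (bracket X Y) f = anchor X (anchor Y f) - anchor Y (anchor X f)

/-- The Lie algebroid structure with zero bracket and zero anchor. -/
def LieStructure.trivial (R L : Type*) [CommRing R] [Algebra ℝ R] [AddCommGroup L] [Module R L] :
    LieStructure R L where
  bracket := 0
  anchor := 0
  bracket_self := by simp
  jacobi := by simp
  leibniz := by simp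
  anchor_bracket := by simp

/-- The canonical form `⟨X + ξ, Y + η⟩ = ξ(Y) + η(X)` on the sections of `A ⊕ A*`. The sections of
`A*` are the `C^∞(M)`-linear forms on the sections of `A`. -/
def canonicalForm (R L : Type*) [CommRing R] [AddCommGroup L] [Module R L] :
    LinearMap.BilinForm R (L × Module.Dual R L) :=
  LinearMap.mk₂ R (fun u v => u.2 v.1 + v.2 u.1)
    (fun u u' v => by simp; ring) (fun c u v => by simp; ring)
    (fun u v v' => by simp; ring) (fun c u v => by simp; ring)

/-- The element `μ ∈ 𝒜³` of `A ⊕ A*` defined by a Lie algebroid structure on `A`. For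
`u = X + ξ`, `v = Y + η`, `w = Z + ζ`, its value on `[u, v, w]` is
`⟨[X, Y], ζ⟩ + ⟨ℒ_X η, Z⟩ - (dξ)(Y, Z)`, where `ℒ` and `d` are the Lie derivative and the
differential of `A`; its value on a section and a function is given by the anchor. -/
def LieStructure.toFunction (μ : LieStructure R L) : WordFunction R (L × Module.Dual R L)
  | [Sum.inl (X, ξ), Sum.inl (Y, η), Sum.inl (Z, ζ)] =>
      ζ (μ.bracket X Y) + (μ.anchor X (η Z) - η (μ.bracket X Z))
        - (μ.anchor Y (ξ Z) - μ.anchor Z (ξ Y) - ξ (μ.bracket Y Z))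
  | [Sum.inl (X, _), Sum.inr f] => μ.anchor X f
  | [Sum.inr f, Sum.inl (X, _)] => μ.anchor X f
  | _ => 0

/-- The element `γ ∈ 𝒜³` of `A ⊕ A*` defined by a Lie algebroid structure on `A*`. This is the
preceding definition with the roles of `A` and `A*` exchanged. -/
def LieStructure.dualToFunction (γ : LieStructure R (Module.Dual R L)) :
    WordFunction R (L × Module.Dual R L)
  | [Sum.inl (X, ξ), Sum.inl (Y, η), Sum.inl (Z, ζ)] =>
      γ.bracket ξ η Z + (γ.anchor ξ (ζ Y) - γ.bracket ξ ζ Y)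
        - (γ.anchor η (ζ X) - γ.anchor ζ (η X) - γ.bracket η ζ X)
  | [Sum.inl (_, ξ), Sum.inr f] => γ.anchor ξ f
  | [Sum.inr f, Sum.inl (_, ξ)] => γ.anchor ξ f
  | _ => 0

/-- `((A, μ), (A*, γ))` is a Lie bialgebroid. -/
def IsLieBialgebroid (μ : LieStructure R L) (γ : LieStructure R (Module.Dual R L)) : Prop :=
  poisson (canonicalForm R L) μ.toFunction μ.toFunction = 0 ∧
  poisson (canonicalForm R L) μ.toFunction γ.dualToFunction = 0 ∧
  poisson (canonicalForm R L) γ.dualToFunction γ.dualToFunction = 0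

/-- The structure `μ + γ` of the double of `((A, μ), (A*, γ))`. -/
def double (μ : LieStructure R L) (γ : LieStructure R (Module.Dual R L)) :
    WordFunction R (L × Module.Dual R L) := μ.toFunction + γ.dualToFunction

/-- The endomorphism `𝒩 = diag(N, -ᵗN)` of `A ⊕ A*`. -/
def diagonalEndomorphism (N : L →ₗ[R] L) : L × Module.Dual R L →ₗ[R] L × Module.Dual R L :=
  N.prodMap (-N.dualMap)

/-- The deformed bracket `[X, Y]_N = [N X, Y] + [X, N Y] - N [X, Y]`. -/
def deformedBracket (μ : LieStructure R L) (N : L →ₗ[R] L) (X Y : L) : L :=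
  μ.bracket (N X) Y + μ.bracket X (N Y) - N (μ.bracket X Y)

/-- The Nijenhuis torsion of `N` vanishes. -/
def IsNijenhuis (μ : LieStructure R L) (N : L →ₗ[R] L) : Prop :=
  ∀ X Y, μ.bracket (N X) (N Y) - N (deformedBracket μ N X Y) = 0

end Double

/-! ## Vector bundles and Lie algebroids over a manifold -/

section Geometry

variable {E : Type*} [NormedAddCommGroup E] [NormedSpace ℝ E]
  {H : Type*} [TopologicalSpace H] {I : ModelWithCorners ℝ E H}
  {M : Type*} [TopologicalSpace M] [ChartedSpace H M]
  {F : Type*} [NormedAddCommGroup F] [NormedSpace ℝ F]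
  {V : M → Type*} [TopologicalSpace (Bundle.TotalSpace F V)]
  [∀ x, AddCommGroup (V x)] [∀ x, Module ℝ (V x)] [∀ x, TopologicalSpace (V x)]
  [FiberBundle F V] [VectorBundle ℝ F V]
  {F' : Type*} [NormedAddCommGroup F'] [NormedSpace ℝ F']
  {V' : M → Type*} [TopologicalSpace (Bundle.TotalSpace F' V')]
  [∀ x, AddCommGroup (V' x)] [∀ x, Module ℝ (V' x)] [∀ x, TopologicalSpace (V' x)]
  [FiberBundle F' V'] [VectorBundle ℝ F' V']

/-- The smooth sections of a vector bundle form a module over the smooth functions. -/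
noncomputable instance sectionModule : Module C^∞⟮I, M; ℝ⟯ Cₛ^∞⟮I; F, V⟯ where
  smul f s := ⟨fun x => f x • s x, f.contMDiff.smul_section s.contMDiff⟩
  one_smul s := by ext x; exact one_smul ℝ (s x)
  mul_smul f g s := by ext x; exact mul_smul (f x) (g x) (s x)
  smul_zero f := by ext x; exact smul_zero (f x)
  smul_add f s t := by ext x; exact smul_add (f x) (s x) (t x)
  add_smul f g s := by ext x; exact add_smul (f x) (g x) (s x)
  zero_smul s := by ext x; exact zero_smul ℝ (s x)

/-- A smooth vector bundle morphism over the identity of `M`. -/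
structure BundleMorphism (I : ModelWithCorners ℝ E H) (F : Type*) [NormedAddCommGroup F]
    [NormedSpace ℝ F] (V : M → Type*) [TopologicalSpace (Bundle.TotalSpace F V)]
    [∀ x, AddCommGroup (V x)] [∀ x, Module ℝ (V x)] [∀ x, TopologicalSpace (V x)]
    [FiberBundle F V] [VectorBundle ℝ F V]
    (F' : Type*) [NormedAddCommGroup F'] [NormedSpace ℝ F']
    (V' : M → Type*) [TopologicalSpace (Bundle.TotalSpace F' V')]
    [∀ x, AddCommGroup (V' x)] [∀ x, Module ℝ (V' x)] [∀ x, TopologicalSpace (V' x)]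
    [FiberBundle F' V'] [VectorBundle ℝ F' V'] where
  toFun : ∀ x, V x →ₗ[ℝ] V' x
  smooth : ∀ s : Cₛ^∞⟮I; F, V⟯, ContMDiff I (I.prod 𝓘(ℝ, F')) ∞
    (fun x => Bundle.TotalSpace.mk' F' x (toFun x (s x)))

/-- The map on sections induced by a vector bundle morphism. -/
noncomputable def BundleMorphism.onSections (φ : BundleMorphism I F V F' V') :
    Cₛ^∞⟮I; F, V⟯ →ₗ[C^∞⟮I, M; ℝ⟯] Cₛ^∞⟮I; F', V'⟯ where
  toFun s := ⟨fun x => φ.toFun x (s x), φ.smooth s⟩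
  map_add' s t := by ext x; exact (φ.toFun x).map_add (s x) (t x)
  map_smul' f s := by ext x; exact (φ.toFun x).map_smul (f x) (s x)

variable [IsManifold I ∞ M]

theorem contMDiff_directional (X : Cₛ^∞⟮I; E, (TangentSpace I : M → Type _)⟯)
    (f : C^∞⟮I, M; ℝ⟯) : ContMDiff I 𝓘(ℝ, ℝ) ∞ (fun x => mvfderiv I f x (X x)) := by
  have : IsManifold I 1 M := IsManifold.of_le (n := ∞) (by norm_cast)
  have h1 : ContMDiff I.tangent 𝓘(ℝ, ℝ).tangent ∞ (tangentMap I 𝓘(ℝ, ℝ) f) :=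
    f.contMDiff.contMDiff_tangentMap (by norm_cast)
  exact (contMDiff_snd_tangentBundle_modelSpace ℝ 𝓘(ℝ, ℝ)).comp (h1.comp X.contMDiff)

/-- The action `f ↦ X f = df(X)` of vector fields on functions. -/
noncomputable def vectorFieldDerivation :
    Cₛ^∞⟮I; E, (TangentSpace I : M → Type _)⟯ →ₗ[C^∞⟮I, M; ℝ⟯]
      Derivation ℝ C^∞⟮I, M; ℝ⟯ C^∞⟮I, M; ℝ⟯ where
  toFun X := Derivation.mk'
    { toFun := fun f => ⟨fun x => mvfderiv I f x (X x), contMDiff_directional X f⟩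
      map_add' := fun f g => by
        ext x
        have := mvfderiv_add (I := I) (f.mdifferentiableAt (x := x)) (g.mdifferentiableAt (x := x))
        exact congrArg (fun l => l (X x)) this
      map_smul' := fun c f => by
        ext x
        have h := mvfderiv_smul (I := I) (x := x) (a := fun _ : M => c) (g := f)
          (mdifferentiableAt_const) (f.mdifferentiableAt (x := x))
        rw [mvfderiv_const] at h
        have h' := congrArg (fun l => l (X x)) h
        refine Eq.trans h' ?_
        simp only [add_apply, smul_apply,
          ContinuousLinearMap.smulRight_apply, zero_apply, zero_smul, add_zero]
        rfl }
    (fun f g => by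
      ext x
      have := mvfderiv_mul (I := I) (f.mdifferentiableAt (x := x)) (g.mdifferentiableAt (x := x))
      exact congrArg (fun l => l (X x)) this)
  map_add' X Y := by
    ext f x
    exact (mvfderiv I f x).map_add (X x) (Y x)
  map_smul' g X := by
    ext f x
    exact (mvfderiv I f x).map_smul (g x) (X x)

/-- A Lie algebroid structure on the vector bundle `V` over the manifold `M`. -/
structure LieAlgebroid (I : ModelWithCorners ℝ E H) [IsManifold I ∞ M] (F : Type*)
    [NormedAddCommGroup F] [NormedSpace ℝ F] (V : M → Type*)
    [TopologicalSpace (Bundle.TotalSpace F V)]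
    [∀ x, AddCommGroup (V x)] [∀ x, Module ℝ (V x)] [∀ x, TopologicalSpace (V x)]
    [FiberBundle F V] [VectorBundle ℝ F V] where
  /-- The Lie bracket of sections. -/
  bracket : Cₛ^∞⟮I; F, V⟯ →+ Cₛ^∞⟮I; F, V⟯ →+ Cₛ^∞⟮I; F, V⟯
  /-- The anchor, a morphism from `V` to the tangent bundle. -/
  anchor : BundleMorphism I F V E (TangentSpace I : M → Type _)
  bracket_self : ∀ X, bracket X X = 0
  jacobi : ∀ X Y Z,
    bracket X (bracket Y Z) = bracket (bracket X Y) Z + bracket Y (bracket X Z)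
  leibniz : ∀ X (f : C^∞⟮I, M; ℝ⟯) Y,
    bracket X (f • Y) = f • bracket X Y + vectorFieldDerivation (anchor.onSections X) f • Y
  anchor_bracket : ∀ X Y f,
    vectorFieldDerivation (anchor.onSections (bracket X Y)) f =
      vectorFieldDerivation (anchor.onSections X) (vectorFieldDerivation (anchor.onSections Y) f)
      - vectorFieldDerivation (anchor.onSections Y)
          (vectorFieldDerivation (anchor.onSections X) f)

/-- The structure on sections of a Lie algebroid. -/
noncomputable def LieAlgebroid.toLieStructure (μ : LieAlgebroid I F V) :
    LieStructure C^∞⟮I, M; ℝ⟯ Cₛ^∞⟮I; F, V⟯ where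
  bracket := μ.bracket
  anchor := vectorFieldDerivation ∘ₗ μ.anchor.onSections
  bracket_self := μ.bracket_self
  jacobi := μ.jacobi
  leibniz := μ.leibniz
  anchor_bracket := μ.anchor_bracket

end Geometry

end CourantNijenhuis

open CourantNijenhuis

namespace CourantNijenhuis

/-! The mechanism is that bracketing with `𝒩~` deforms a Lie algebroid structure inside the same
class: `{𝒩~, μ}` is the function of `μ_N`, the structure with bracket `[X, Y]_N` and anchor `ρ ∘ N`
(`poisson_tilde_toFunction`). Vanishing torsion, in the form `N [X, Y]_N = [N X, N Y]`, makes `μ_N`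
a Lie algebroid structure (`LieStructure.deform`), and every Lie algebroid structure satisfies `{μ,
μ} = 0` by Jacobi and the anchor being a morphism (`poisson_toFunction_self`). This settles the
Courant structure and the trivial double.

For the weak deforming property, graded antisymmetry (`poisson_swap`) and a second deformation give
`{{𝒩~, μ}, 𝒩~} = -{𝒩~, μ_N} = -μ_{N²}`. Now `N²` is again Nijenhuis for `μ`, so it suffices that
`{μ, μ_N} = 0` for every Nijenhuis `N`. This follows by polarization: `id + N` is Nijenhuis and
deforms `μ` into `μ + μ_N`; expanding `{μ + μ_N, μ + μ_N} = 0` leaves `2 {μ, μ_N} = 0`. Hence no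
condition on `N²` is needed.

The word-function bracket involves `sharp`, which is meaningful only where a linear form is
represented by a unique section. Uniqueness comes from nondegeneracy of the canonical form, proved
on the manifold with bump functions; existence is tracked by `IsRepresentable`. -/

theorem wordDegree_append {R E : Type*} (w w' : List (E ⊕ R)) :
    wordDegree (w ++ w') = wordDegree w + wordDegree w' := by
  induction w with
  | nil => simp [wordDegree]
  | cons x w ih => rcases x with x | x <;> simp [wordDegree, ih] <;> ring

/-! ### Degree and parity of word functions. -/

section Support

variable {R E : Type*} [CommRing R]

/-- `a` vanishes on the words whose degree is not `n`. -/
def IsSupportedIn (n : ℤ) (a : WordFunction R E) : Prop :=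
  ∀ w, (wordDegree w : ℤ) ≠ n → a w = 0

namespace IsSupportedIn

variable {n : ℤ} {a : WordFunction R E}

theorem contract_section (ha : IsSupportedIn n a) (u : E) :
    IsSupportedIn (n - 1) (contract (Sum.inl u) a) := fun w hw =>
  ha _ (by simp only [wordDegree]; push_cast; omega)

theorem contract_function (ha : IsSupportedIn n a) (f : R) :
    IsSupportedIn (n - 2) (contract (Sum.inr f) a) := fun w hw =>
  ha _ (by simp only [wordDegree]; push_cast; omega)

theorem parityFlip (ha : IsSupportedIn n a) : IsSupportedIn n (parityFlip a) := fun w hw => by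
  simp [CourantNijenhuis.parityFlip, ha w hw]

/-- All words on which `a` can be nonzero have the same parity, so the sign depending on the word
becomes a global one. -/
theorem parityFlip_eq (ha : IsSupportedIn n a) :
    CourantNijenhuis.parityFlip a = if Even n then a else -a := by
  ext w
  by_cases hw : (wordDegree w : ℤ) = n
  · by_cases h : Even n
    · have : Even (wordDegree w) := by rw [← hw] at h; exact_mod_cast h
      simp [CourantNijenhuis.parityFlip, h, this.neg_one_pow]
    · have : Odd (wordDegree w) := by
        rw [← hw] at h; rw [← Nat.not_even_iff_odd]; exact_mod_cast h
      simp [CourantNijenhuis.parityFlip, h, this.neg_one_pow]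
  · split_ifs <;> simp [CourantNijenhuis.parityFlip, ha w hw]

end IsSupportedIn

end Support

/-! ### Additivity, degree and graded antisymmetry of the Poisson bracket. -/

section GradedPoissonLemmas

variable {R E : Type*} [CommRing R] [AddCommGroup E] [Module R E]

/-- Nondegeneracy of a form, on the level of sections. -/
def SeparatingForm (B : LinearMap.BilinForm R E) : Prop := ∀ e, (∀ u, B e u = 0) → e = 0

/-- Nondegeneracy makes the representing section unique, so any explicit representative computes the
choice made in `sharp`. -/
theorem SeparatingForm.sharp_eq {B : LinearMap.BilinForm R E} (hB : SeparatingForm B)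
    {φ : E → R} {e : E} (h : ∀ u, φ u = B e u) : sharp B φ = e := by
  have hex : ∃ e, ∀ u, B e u = φ u := ⟨e, fun u => (h u).symm⟩
  rw [sharp, dif_pos hex]
  refine sub_eq_zero.1 (hB _ fun u => ?_)
  rw [map_sub, LinearMap.sub_apply, hex.choose_spec u, h u, sub_self]

theorem SeparatingForm.sharp_zero {B : LinearMap.BilinForm R E} (hB : SeparatingForm B) :
    sharp B (fun _ => 0) = 0 := hB.sharp_eq (by simp)

/-- Word functions which are represented by sections in a last section letter, and additive in a
last function letter. -/
structure IsRepresentable (B : LinearMap.BilinForm R E) (a : WordFunction R E) : Prop where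
  last_section : ∀ w, ∃ e, ∀ u, a (w ++ [Sum.inl u]) = B e u
  last_function : ∀ w f g,
    a (w ++ [Sum.inr (f + g)]) = a (w ++ [Sum.inr f]) + a (w ++ [Sum.inr g])

namespace IsRepresentable

variable {B : LinearMap.BilinForm R E} {a b : WordFunction R E}

theorem contract (ha : IsRepresentable B a) (x : E ⊕ R) : IsRepresentable B (contract x a) :=
  ⟨fun w => ha.last_section (x :: w), fun w => ha.last_function (x :: w)⟩

theorem add (ha : IsRepresentable B a) (hb : IsRepresentable B b) :
    IsRepresentable B (a + b) := by
  refine ⟨fun w => ?_, fun w f g => ?_⟩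
  · obtain ⟨e, he⟩ := ha.last_section w
    obtain ⟨e', he'⟩ := hb.last_section w
    exact ⟨e + e', fun u => by simp [he, he']⟩
  · simp only [Pi.add_apply, ha.last_function, hb.last_function]; ring

theorem neg (ha : IsRepresentable B a) : IsRepresentable B (-a) := by
  refine ⟨fun w => ?_, fun w f g => ?_⟩
  · obtain ⟨e, he⟩ := ha.last_section w
    exact ⟨-e, fun u => by simp [he]⟩
  · simp only [Pi.neg_apply, ha.last_function]; ring

theorem zero : IsRepresentable B (0 : WordFunction R E) :=
  ⟨fun _ => ⟨0, by simp⟩, by simp⟩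

end IsRepresentable

theorem IsRepresentable.parityFlip {B : LinearMap.BilinForm R E} {a : WordFunction R E}
    (ha : IsRepresentable B a) : IsRepresentable B (parityFlip a) := by
  refine ⟨fun w => ?_, fun w f g => ?_⟩
  · obtain ⟨e, he⟩ := ha.last_section w
    refine ⟨((-1 : R) ^ (wordDegree w + 1)) • e, fun u => ?_⟩
    simp [CourantNijenhuis.parityFlip, wordDegree_append, wordDegree, he]
  · simp [CourantNijenhuis.parityFlip, wordDegree_append, wordDegree, ha.last_function, mul_add]

theorem IsRepresentable.function_zero {B : LinearMap.BilinForm R E} {a : WordFunction R E}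
    (ha : IsRepresentable B a) : a [Sum.inr 0] = 0 := by
  simpa using ha.last_function [] 0 0

section Bracket

variable {B : LinearMap.BilinForm R E}
-- This is not automatic: `sharp` has the default value `0`, and word functions need not be additive
-- in their letters. Representability repairs both terms at the empty word, and it is inherited by
-- the contractions and parity flips met in the induction.
theorem bracketAt_add_left (hB : SeparatingForm B) (w : List (E ⊕ R)) {a a' b : WordFunction R E}
    (ha : IsRepresentable B a) (ha' : IsRepresentable B a') (hb : IsRepresentable B b) :
    bracketAt B w (a + a') b = bracketAt B w a b + bracketAt B w a' b := by
  induction w generalizing a a' b with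
  | nil =>
    obtain ⟨e, he⟩ := ha.last_section []
    obtain ⟨e', he'⟩ := ha'.last_section []
    have h := hb.last_function [] (a []) (a' [])
    simp only [List.nil_append] at he he' h
    rw [bracketAt, bracketAt, bracketAt, hB.sharp_eq he, hB.sharp_eq he',
      hB.sharp_eq (φ := fun u => (a + a') [Sum.inl u]) (e := e + e') (by simp [he, he'])]
    simp only [Pi.add_apply, h, map_add, LinearMap.add_apply]
    ring
  | cons x w ih =>
    rcases x with u | f
    · have h : contract (Sum.inl u) (a + a') = contract (Sum.inl u) a + contract (Sum.inl u) a' :=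
        rfl
      simp only [bracketAt, h]
      rw [ih ha ha' (hb.contract _), ih (ha.contract _) (ha'.contract _) hb.parityFlip]
      ring
    · have h : contract (Sum.inr f) (a + a') = contract (Sum.inr f) a + contract (Sum.inr f) a' :=
        rfl
      simp only [bracketAt, h]
      rw [ih ha ha' (hb.contract _), ih (ha.contract _) (ha'.contract _) hb]
      ring

theorem bracketAt_add_right (hB : SeparatingForm B) (w : List (E ⊕ R)) {a b b' : WordFunction R E}
    (ha : IsRepresentable B a) (hb : IsRepresentable B b) (hb' : IsRepresentable B b') :
    bracketAt B w a (b + b') = bracketAt B w a b + bracketAt B w a b' := by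
  induction w generalizing a b b' with
  | nil =>
    obtain ⟨e, he⟩ := hb.last_section []
    obtain ⟨e', he'⟩ := hb'.last_section []
    have h := ha.last_function [] (b []) (b' [])
    simp only [List.nil_append] at he he' h
    rw [bracketAt, bracketAt, bracketAt, hB.sharp_eq he, hB.sharp_eq he',
      hB.sharp_eq (φ := fun u => (b + b') [Sum.inl u]) (e := e + e') (by simp [he, he'])]
    simp only [Pi.add_apply, h, map_add]
    ring
  | cons x w ih =>
    rcases x with u | f
    · have h : contract (Sum.inl u) (b + b') = contract (Sum.inl u) b + contract (Sum.inl u) b' :=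
        rfl
      have h' : parityFlip (b + b') = parityFlip b + parityFlip b' := by
        ext w; simp [parityFlip, mul_add]
      simp only [bracketAt, h, h']
      rw [ih ha (hb.contract _) (hb'.contract _),
        ih (ha.contract _) hb.parityFlip hb'.parityFlip]
      ring
    · have h : contract (Sum.inr f) (b + b') = contract (Sum.inr f) b + contract (Sum.inr f) b' :=
        rfl
      simp only [bracketAt, h]
      rw [ih ha (hb.contract _) (hb'.contract _), ih (ha.contract _) hb hb']
      ring

theorem poisson_add_left (hB : SeparatingForm B) {a a' b : WordFunction R E} (ha : IsRepresentable B a)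
    (ha' : IsRepresentable B a') (hb : IsRepresentable B b) :
    poisson B (a + a') b = poisson B a b + poisson B a' b :=
  funext fun w => bracketAt_add_left hB w ha ha' hb

theorem poisson_add_right (hB : SeparatingForm B) {a b b' : WordFunction R E} (ha : IsRepresentable B a)
    (hb : IsRepresentable B b) (hb' : IsRepresentable B b') :
    poisson B a (b + b') = poisson B a b + poisson B a b' :=
  funext fun w => bracketAt_add_right hB w ha hb hb'

theorem poisson_zero_right (hB : SeparatingForm B) {a : WordFunction R E} (ha : IsRepresentable B a) :
    poisson B a 0 = 0 := by
  simpa using poisson_add_right hB ha IsRepresentable.zero IsRepresentable.zero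

theorem poisson_neg_right (hB : SeparatingForm B) {a b : WordFunction R E} (ha : IsRepresentable B a)
    (hb : IsRepresentable B b) : poisson B a (-b) = -poisson B a b := by
  have h := poisson_add_right hB ha hb hb.neg
  rw [add_neg_cancel, poisson_zero_right hB ha] at h
  exact (neg_eq_of_add_eq_zero_right h.symm).symm

end Bracket

/-- The bracket has degree `-2`: each letter lowers the degree of one factor by its own degree, and
at the empty word only the degrees `(1, 1)`, `(2, 0)`, `(0, 2)` contribute. Degrees are integers
because repeated contraction can make them negative. -/
theorem bracketAt_eq_zero {B : LinearMap.BilinForm R E} (hB : SeparatingForm B)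
    (w : List (E ⊕ R)) {p q : ℤ} {a b : WordFunction R E}
    (ha : IsRepresentable B a) (hb : IsRepresentable B b)
    (hp : IsSupportedIn p a) (hq : IsSupportedIn q b) (hw : (wordDegree w : ℤ) + 2 ≠ p + q) :
    bracketAt B w a b = 0 := by
  induction w generalizing a b p q with
  | nil =>
    simp only [wordDegree] at hw
    have h1 : B (sharp B fun u => a [Sum.inl u]) (sharp B fun u => b [Sum.inl u]) = 0 := by
      by_cases h : p = 1
      · have : (fun u => b [Sum.inl u]) = fun _ => 0 :=
          funext fun u => hq _ (by simp only [wordDegree]; push_cast at hw ⊢; omega)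
        rw [this, hB.sharp_zero, map_zero]
      · have : (fun u => a [Sum.inl u]) = fun _ => 0 :=
          funext fun u => hp _ (by simp only [wordDegree]; push_cast at hw ⊢; omega)
        rw [this, hB.sharp_zero, map_zero, LinearMap.zero_apply]
    have h2 : a [Sum.inr (b [])] = 0 := by
      by_cases h : p = 2
      · rw [hq [] (by simp only [wordDegree]; push_cast at hw ⊢; omega), ha.function_zero]
      · exact hp _ (by simp only [wordDegree]; push_cast; omega)
    have h3 : b [Sum.inr (a [])] = 0 := by
      by_cases h : q = 2
      · rw [hp [] (by simp only [wordDegree]; push_cast at hw ⊢; omega), hb.function_zero]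
      · exact hq _ (by simp only [wordDegree]; push_cast; omega)
    rw [bracketAt, h1, h2, h3]; ring
  | cons x w ih =>
    rcases x with u | f
    · simp only [wordDegree] at hw
      push_cast at hw
      rw [bracketAt, ih ha (hb.contract _) hp (hq.contract_section u) (by omega),
        ih (ha.contract _) hb.parityFlip (hp.contract_section u) hq.parityFlip (by omega), add_zero]
    · simp only [wordDegree] at hw
      push_cast at hw
      rw [bracketAt, ih ha (hb.contract _) hp (hq.contract_function f) (by omega),
        ih (ha.contract _) hb (hp.contract_function f) hq (by omega), add_zero]

/-- Graded antisymmetry, `{a, b} = -(-1) ^ (p q) {b, a}`, by induction on the word from the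
recursive Jacobi rule. -/
theorem poisson_swap {B : LinearMap.BilinForm R E} (hB : SeparatingForm B)
    (hsymm : ∀ u v, B u v = B v u) {p q : ℤ} {a b : WordFunction R E}
    (ha : IsRepresentable B a) (hb : IsRepresentable B b)
    (hp : IsSupportedIn p a) (hq : IsSupportedIn q b) :
    poisson B a b = if Even (p * q) then -poisson B b a else poisson B b a := by
  have neg_left : ∀ {a b : WordFunction R E} (w), IsRepresentable B a → IsRepresentable B b →
      bracketAt B w (-a) b = -bracketAt B w a b := fun {a b} w ha hb => by
    have h := bracketAt_add_left hB w ha ha.neg hb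
    have h0 := bracketAt_add_left hB w (a := 0) (a' := 0) .zero .zero hb
    rw [add_zero, left_eq_add] at h0
    rw [add_neg_cancel, h0] at h
    exact (neg_eq_of_add_eq_zero_right h.symm).symm
  have neg_right : ∀ {a b : WordFunction R E} (w), IsRepresentable B a → IsRepresentable B b →
      bracketAt B w a (-b) = -bracketAt B w a b := fun {a b} w ha hb =>
    congrFun (poisson_neg_right hB ha hb) w
  have key : ∀ (w : List (E ⊕ R)) {p q : ℤ} {a b : WordFunction R E},
      IsRepresentable B a → IsRepresentable B b → IsSupportedIn p a → IsSupportedIn q b →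
      bracketAt B w a b = if Even (p * q) then -bracketAt B w b a else bracketAt B w b a := by
    intro w
    induction w with
    | nil =>
      intro p q a b ha hb hp hq
      -- Otherwise both sides vanish. When `p + q = 2` the degrees have equal parity: if even, only
      -- the two antisymmetric terms survive; if odd, only the symmetric pairing does.
      by_cases hw : p + q = 2
      · rw [bracketAt, bracketAt, hsymm (sharp B fun u => b [Sum.inl u])]
        by_cases h : Even p
        · have hp1 : p ≠ 1 := by rintro rfl; simp at h
          have : (fun u => a [Sum.inl u]) = fun _ => 0 :=
            funext fun u => hp _ (by simp only [wordDegree]; push_cast; omega)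
          rw [if_pos (h.mul_right q), this, hB.sharp_zero, map_zero, LinearMap.zero_apply]
          ring
        · have hp2 : p ≠ 2 := by rintro rfl; simp at h
          have hp0 : p ≠ 0 := by rintro rfl; simp at h
          have hq' : ¬ Even q := by
            have : q = 2 - p := by omega
            rw [this, Int.even_sub]; simp [h]
          rw [if_neg (by simp [Int.even_mul, h, hq']),
            hp [Sum.inr (b [])] (by simp only [wordDegree]; push_cast; omega),
            hq [Sum.inr (a [])] (by simp only [wordDegree]; push_cast; omega)]
      · rw [bracketAt_eq_zero hB [] ha hb hp hq (by simp only [wordDegree]; push_cast; omega),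
          bracketAt_eq_zero hB [] hb ha hq hp (by simp only [wordDegree]; push_cast; omega)]
        simp
    | cons x w ih =>
      intro p q a b ha hb hp hq
      rcases x with u | f
      · rw [bracketAt, bracketAt, hp.parityFlip_eq, hq.parityFlip_eq,
          ih ha (hb.contract _) hp (hq.contract_section u)]
        by_cases h : Even p <;> by_cases h' : Even q <;>
          simp only [h, h', if_true, if_false, Int.even_mul, Int.even_sub, Int.not_even_one,
            neg_right w (ha.contract (Sum.inl u)) hb, neg_right w (hb.contract (Sum.inl u)) ha,
            ih (ha.contract (Sum.inl u)) hb (hp.contract_section u) hq] <;>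
          simp <;> ring
      · rw [bracketAt, bracketAt, ih ha (hb.contract _) hp (hq.contract_function f),
          ih (ha.contract _) hb (hp.contract_function f) hq]
        by_cases h : Even p <;> by_cases h' : Even q <;>
          simp [h, h', Int.even_mul] <;> ring
  ext w
  rw [poisson, key w ha hb hp hq]
  split_ifs <;> rfl

end GradedPoissonLemmas

/-! ### Nondegeneracy of the canonical form. -/

section CanonicalForm

variable {R L : Type*} [CommRing R] [AddCommGroup L] [Module R L]

theorem canonicalForm_apply (u v : L × Module.Dual R L) :
    canonicalForm R L u v = u.2 v.1 + v.2 u.1 := rfl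

theorem canonicalForm_symm (u v : L × Module.Dual R L) :
    canonicalForm R L u v = canonicalForm R L v u := add_comm _ _

/-- The canonical form on `L ⊕ L*` is nondegenerate if the elements of `L` are separated by linear
forms. -/
theorem canonicalForm_separating (hL : ∀ X : L, (∀ ξ : Module.Dual R L, ξ X = 0) → X = 0) :
    SeparatingForm (canonicalForm R L) := by
  rintro ⟨X, ξ⟩ h
  refine Prod.ext (hL X fun η => ?_) (LinearMap.ext fun Y => ?_)
  · simpa [canonicalForm_apply] using h (0, η)
  · simpa [canonicalForm_apply] using h (Y, 0)

end CanonicalForm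

/-! ### The cubic function of a Lie algebroid structure and its master equation. -/

section LieStructures

variable {R L : Type*} [CommRing R] [Algebra ℝ R] [AddCommGroup L] [Module R L]

namespace LieStructure

variable (μ : LieStructure R L)

theorem bracket_skew (X Y : L) : μ.bracket X Y = -μ.bracket Y X := by
  have h := μ.bracket_self (X + Y)
  simp only [map_add, AddMonoidHom.add_apply, μ.bracket_self, zero_add, add_zero] at h
  exact eq_neg_of_add_eq_zero_right h

/-- The Dorfman bracket of `L ⊕ L*` defined by a Lie algebroid structure on `L`. -/
def dorfman (u v : L × Module.Dual R L) : L × Module.Dual R L :=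
  (μ.bracket u.1 v.1,
    { toFun := fun Z => (μ.anchor u.1 (v.2 Z) - v.2 (μ.bracket u.1 Z))
        - (μ.anchor v.1 (u.2 Z) - μ.anchor Z (u.2 v.1) - u.2 (μ.bracket v.1 Z))
      map_add' := fun Z Z' => by simp only [map_add, Derivation.add_apply]; ring
      map_smul' := fun f Z => by
        simp only [map_smul, leibniz, map_add, smul_eq_mul, Derivation.leibniz,
          Derivation.smul_apply, RingHom.id_apply]
        ring })

/-- The differential of a function, as a linear form on `L`. -/
def differential (f : R) : Module.Dual R L where
  toFun X := μ.anchor X f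
  map_add' X Y := by simp
  map_smul' g X := by simp

theorem toFunction_section (u v w : L × Module.Dual R L) :
    μ.toFunction [Sum.inl u, Sum.inl v, Sum.inl w] = canonicalForm R L (μ.dorfman u v) w := by
  obtain ⟨X, ξ⟩ := u
  obtain ⟨Y, η⟩ := v
  obtain ⟨Z, ζ⟩ := w
  simp only [toFunction, canonicalForm_apply, dorfman, LinearMap.coe_mk, AddHom.coe_mk]
  ring

theorem toFunction_function_section (f : R) (u : L × Module.Dual R L) :
    μ.toFunction [Sum.inr f, Sum.inl u] = canonicalForm R L (0, μ.differential f) u := by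
  simp [toFunction, canonicalForm_apply, differential]

theorem toFunction_supported : ∀ w, wordDegree w ≠ 3 → μ.toFunction w = 0 := by
  intro w hw
  unfold toFunction
  split <;> simp [wordDegree] at hw ⊢

end LieStructure

theorem wordDegree_eq_zero {R E : Type*} {w : List (E ⊕ R)} (h : wordDegree w = 0) : w = [] := by
  rcases w with _ | ⟨x | x, w⟩ <;> simp [wordDegree] at h ⊢

theorem wordDegree_eq_one {R E : Type*} {w : List (E ⊕ R)} (h : wordDegree w = 1) :
    ∃ u, w = [Sum.inl u] := by
  rcases w with _ | ⟨x | x, w⟩ <;> simp [wordDegree] at h ⊢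
  exact wordDegree_eq_zero h

theorem wordDegree_eq_two {R E : Type*} {w : List (E ⊕ R)} (h : wordDegree w = 2) :
    (∃ u v, w = [Sum.inl u, Sum.inl v]) ∨ ∃ f, w = [Sum.inr f] := by
  rcases w with _ | ⟨x | x, w⟩ <;> simp [wordDegree] at h ⊢
  · exact wordDegree_eq_one h
  · exact wordDegree_eq_zero h

theorem wordDegree_eq_three {R E : Type*} {w : List (E ⊕ R)} (h : wordDegree w = 3) :
    (∃ u v x, w = [Sum.inl u, Sum.inl v, Sum.inl x]) ∨ (∃ u f, w = [Sum.inl u, Sum.inr f]) ∨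
      ∃ f u, w = [Sum.inr f, Sum.inl u] := by
  rcases w with _ | ⟨x | x, w⟩ <;> simp [wordDegree] at h ⊢
  · exact wordDegree_eq_two h
  · exact wordDegree_eq_one h

theorem wordDegree_eq_four {R E : Type*} {w : List (E ⊕ R)} (h : wordDegree w = 4) :
    (∃ u v x y, w = [Sum.inl u, Sum.inl v, Sum.inl x, Sum.inl y]) ∨
      (∃ u v f, w = [Sum.inl u, Sum.inl v, Sum.inr f]) ∨
      (∃ u f v, w = [Sum.inl u, Sum.inr f, Sum.inl v]) ∨
      (∃ f u v, w = [Sum.inr f, Sum.inl u, Sum.inl v]) ∨ ∃ f g, w = [Sum.inr f, Sum.inr g] := by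
  rcases w with _ | ⟨x | x, w⟩ <;> simp [wordDegree] at h ⊢
  · exact wordDegree_eq_three h
  · exact wordDegree_eq_two h

namespace LieStructure

variable (μ : LieStructure R L)

theorem isOfDegree_toFunction : IsOfDegree (canonicalForm R L) 3 μ.toFunction where
  support := μ.toFunction_supported
  swap_sections w u v w' := by
    by_cases h : wordDegree w + wordDegree w' = 1
    -- The remaining section letter stands after or before the swapped pair. The first case is the
    -- symmetric part of the Dorfman bracket, the second the invariance of the form under it.
    · rcases Nat.add_eq_one_iff.1 h with ⟨h1, h2⟩ | ⟨h1, h2⟩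
      · obtain rfl := wordDegree_eq_zero h1
        obtain ⟨z, rfl⟩ := wordDegree_eq_one h2
        simp only [toFunction, List.nil_append, canonicalForm_apply, map_add,
          μ.bracket_skew v.1 u.1, map_neg]
        ring
      · obtain rfl := wordDegree_eq_zero h2
        obtain ⟨z, rfl⟩ := wordDegree_eq_one h1
        simp only [toFunction, List.cons_append, List.nil_append, canonicalForm_apply, map_add,
          μ.bracket_skew v.1 u.1, map_neg]
        ring
    · rw [μ.toFunction_supported, μ.toFunction_supported, μ.toFunction_supported, add_zero] <;>
        simp only [wordDegree_append, wordDegree] <;> omega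
  swap_section_function w u f w' := by
    by_cases h : wordDegree w + wordDegree w' = 0
    · obtain rfl := wordDegree_eq_zero (Nat.add_eq_zero_iff.1 h).1
      obtain rfl := wordDegree_eq_zero (Nat.add_eq_zero_iff.1 h).2
      rfl
    · rw [μ.toFunction_supported, μ.toFunction_supported] <;>
        simp only [wordDegree_append, wordDegree] <;> omega
  swap_functions w f g w' := by
    rw [μ.toFunction_supported, μ.toFunction_supported] <;>
      simp only [wordDegree_append, wordDegree] <;> omega
  last_section w := by
    by_cases h : wordDegree w = 2
    · rcases wordDegree_eq_two h with ⟨u, v, rfl⟩ | ⟨f, rfl⟩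
      · exact ⟨canonicalForm R L (μ.dorfman u v), fun x => μ.toFunction_section u v x⟩
      · exact ⟨canonicalForm R L (0, μ.differential f), μ.toFunction_function_section f⟩
    · refine ⟨0, fun u => μ.toFunction_supported _ ?_⟩
      simp only [wordDegree_append, wordDegree]; omega
  last_function w := by
    by_cases h : wordDegree w = 1
    · obtain ⟨u, rfl⟩ := wordDegree_eq_one h
      exact ⟨μ.anchor u.1, fun _ => rfl⟩
    · refine ⟨0, fun u => μ.toFunction_supported _ ?_⟩
      simp only [wordDegree_append, wordDegree]; omega

/-- The Dorfman bracket and the differential provide explicit representatives, so reflexivity of the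
module of sections is not required. -/
theorem isRepresentable_toFunction : IsRepresentable (canonicalForm R L) μ.toFunction where
  last_section w := by
    by_cases h : wordDegree w = 2
    · rcases wordDegree_eq_two h with ⟨u, v, rfl⟩ | ⟨f, rfl⟩
      · exact ⟨μ.dorfman u v, fun x => μ.toFunction_section u v x⟩
      · exact ⟨(0, μ.differential f), μ.toFunction_function_section f⟩
    · refine ⟨0, fun u => ?_⟩
      rw [map_zero, LinearMap.zero_apply, μ.toFunction_supported]
      simp only [wordDegree_append, wordDegree]; omega
  last_function w f g := by
    obtain ⟨D, hD⟩ := μ.isOfDegree_toFunction.last_function w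
    simp only [hD, map_add]

theorem isSupportedIn_toFunction : IsSupportedIn 3 μ.toFunction := fun w hw =>
  μ.toFunction_supported w (by exact_mod_cast hw)

theorem sharp_toFunction_section (hL : SeparatingForm (canonicalForm R L))
    (u v : L × Module.Dual R L) :
    sharp (canonicalForm R L) (fun w => μ.toFunction [Sum.inl u, Sum.inl v, Sum.inl w]) =
      μ.dorfman u v :=
  hL.sharp_eq fun w => μ.toFunction_section u v w

theorem sharp_toFunction_function (hL : SeparatingForm (canonicalForm R L)) (f : R) :
    sharp (canonicalForm R L) (fun w => μ.toFunction [Sum.inr f, Sum.inl w]) =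
      (0, μ.differential f) :=
  hL.sharp_eq fun w => μ.toFunction_function_section f w

/-- Signed variants are needed because `parityFlip` puts a sign inside the argument of `sharp`. -/
theorem sharp_toFunction_neg (hL : SeparatingForm (canonicalForm R L))
    (u v : L × Module.Dual R L) :
    sharp (canonicalForm R L) (fun w => -μ.toFunction [Sum.inl u, Sum.inl v, Sum.inl w]) =
      -μ.dorfman u v :=
  hL.sharp_eq fun w => by rw [μ.toFunction_section u v w]; simp

theorem sharp_toFunction_function_neg (hL : SeparatingForm (canonicalForm R L)) (f : R) :
    sharp (canonicalForm R L) (fun w => -μ.toFunction [Sum.inr f, Sum.inl w]) =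
      -(0, μ.differential f) :=
  hL.sharp_eq fun w => by rw [μ.toFunction_function_section f w, map_neg, LinearMap.neg_apply]

set_option linter.unusedSimpArgs false in
theorem poisson_toFunction_self (hL : SeparatingForm (canonicalForm R L)) :
    poisson (canonicalForm R L) μ.toFunction μ.toFunction = 0 := by
  have hs2 : (-1 : R) ^ 2 = 1 := by norm_num
  have hs3 : (-1 : R) ^ 3 = -1 := by norm_num
  have hs4 : (-1 : R) ^ 4 = 1 := by norm_num
  ext w
  by_cases hw : wordDegree w = 4
  swap
  · exact bracketAt_eq_zero hL w μ.isRepresentable_toFunction μ.isRepresentable_toFunction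
      μ.isSupportedIn_toFunction μ.isSupportedIn_toFunction (by norm_num; omega)
  -- Jacobi with every nested bracket on the right, matching the shape of the expanded terms.
  have jacobi_apply : ∀ (ξ : Module.Dual R L) (X Y Z : L), ξ (μ.bracket X (μ.bracket Y Z)) =
      -ξ (μ.bracket Z (μ.bracket X Y)) + ξ (μ.bracket Y (μ.bracket X Z)) := fun ξ X Y Z => by
    rw [μ.jacobi, μ.bracket_skew (μ.bracket X Y) Z, map_add, map_neg]
  rcases wordDegree_eq_four hw with ⟨⟨X, ξ⟩, ⟨Y, η⟩, ⟨Z, ζ⟩, ⟨W, θ⟩, rfl⟩ |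
    ⟨⟨X, ξ⟩, ⟨Y, η⟩, f, rfl⟩ | ⟨⟨X, ξ⟩, f, ⟨Y, η⟩, rfl⟩ | ⟨f, ⟨X, ξ⟩, ⟨Y, η⟩, rfl⟩ | ⟨f, g, rfl⟩
  · simp only [poisson, bracketAt, contract, parityFlip, wordDegree, zero_add, Nat.reduceAdd,
      hs2, hs3, hs4, pow_one, pow_zero, neg_mul, one_mul, neg_neg, mul_neg,
      μ.sharp_toFunction_section hL, μ.sharp_toFunction_function hL, μ.sharp_toFunction_neg hL,
      μ.sharp_toFunction_function_neg hL]
    simp [toFunction, dorfman, differential, canonicalForm_apply, hL.sharp_zero]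
    simp only [anchor_bracket]
    -- Each covector is paired with the Jacobiator of the other three vectors; the factor `2`
    -- reflects the two equal halves of `{μ, μ}`.
    linear_combination (-2) * jacobi_apply θ X Y Z + 2 * jacobi_apply ζ X Y W
      - 2 * jacobi_apply η X Z W + 2 * jacobi_apply ξ Y Z W
  · simp only [poisson, bracketAt, contract, parityFlip, wordDegree, zero_add, Nat.reduceAdd,
      hs2, hs3, hs4, pow_one, pow_zero, neg_mul, one_mul, neg_neg, mul_neg,
      μ.sharp_toFunction_section hL, μ.sharp_toFunction_function hL, μ.sharp_toFunction_neg hL,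
      μ.sharp_toFunction_function_neg hL]
    simp [toFunction, dorfman, differential, canonicalForm_apply, hL.sharp_zero]
    rw [anchor_bracket]
    ring
  · simp only [poisson, bracketAt, contract, parityFlip, wordDegree, zero_add, Nat.reduceAdd,
      hs2, hs3, hs4, pow_one, pow_zero, neg_mul, one_mul, neg_neg, mul_neg,
      μ.sharp_toFunction_section hL, μ.sharp_toFunction_function hL, μ.sharp_toFunction_neg hL,
      μ.sharp_toFunction_function_neg hL]
    simp [toFunction, dorfman, differential, canonicalForm_apply, hL.sharp_zero]
    rw [anchor_bracket]
    ring
  · simp only [poisson, bracketAt, contract, parityFlip, wordDegree, zero_add, Nat.reduceAdd,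
      hs2, hs3, hs4, pow_one, pow_zero, neg_mul, one_mul, neg_neg, mul_neg,
      μ.sharp_toFunction_section hL, μ.sharp_toFunction_function hL, μ.sharp_toFunction_neg hL,
      μ.sharp_toFunction_function_neg hL]
    simp [toFunction, dorfman, differential, canonicalForm_apply, hL.sharp_zero]
    rw [anchor_bracket]
    ring
  · simp only [poisson, bracketAt, contract, parityFlip, wordDegree, zero_add, Nat.reduceAdd,
      hs2, hs3, hs4, pow_one, pow_zero, neg_mul, one_mul, neg_neg, mul_neg,
      μ.sharp_toFunction_section hL, μ.sharp_toFunction_function hL, μ.sharp_toFunction_neg hL,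
      μ.sharp_toFunction_function_neg hL]
    -- Both differentials lie in the isotropic summand `L*`, so their pairing vanishes.
    simp [toFunction, dorfman, differential, canonicalForm_apply, hL.sharp_zero]

end LieStructure

end LieStructures

/-! ### The quadratic function of an endomorphism. -/

section Tilde

variable {R E : Type*} [CommRing R] [AddCommGroup E] [Module R E]
  (B : LinearMap.BilinForm R E) (𝒩 : E →ₗ[R] E)

theorem tilde_section (u v : E) : tilde B 𝒩 [Sum.inl u, Sum.inl v] = -B (𝒩 u) v := rfl

theorem tilde_function (f : R) : tilde B 𝒩 [Sum.inr f] = 0 := rfl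

theorem isSupportedIn_tilde : IsSupportedIn 2 (tilde B 𝒩) := by
  intro w hw
  unfold tilde
  split <;> simp [wordDegree] at hw ⊢

theorem isRepresentable_tilde : IsRepresentable B (tilde B 𝒩) where
  last_section w := by
    by_cases h : wordDegree w = 1
    · obtain ⟨u, rfl⟩ := wordDegree_eq_one h
      exact ⟨-𝒩 u, fun v => by simp [tilde]⟩
    · refine ⟨0, fun u => ?_⟩
      rw [map_zero, LinearMap.zero_apply, isSupportedIn_tilde]
      simp only [wordDegree_append, wordDegree]; push_cast; omega
  last_function w f g := by
    by_cases h : wordDegree w = 0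
    · obtain rfl := wordDegree_eq_zero h
      simp [tilde_function]
    · rw [isSupportedIn_tilde, isSupportedIn_tilde, isSupportedIn_tilde, add_zero] <;>
        · simp only [wordDegree_append, wordDegree]; push_cast; omega

variable {B} in
theorem sharp_tilde (hB : SeparatingForm B) (u : E) :
    sharp B (fun v => tilde B 𝒩 [Sum.inl u, Sum.inl v]) = -𝒩 u :=
  hB.sharp_eq fun v => by rw [tilde_section, map_neg, LinearMap.neg_apply]

end Tilde

theorem isSkewEndomorphism_diagonal {R L : Type*} [CommRing R] [AddCommGroup L] [Module R L]
    (N : L →ₗ[R] L) :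
    IsSkewEndomorphism (canonicalForm R L) (diagonalEndomorphism N) := fun u v => by
  simp [canonicalForm_apply, diagonalEndomorphism]
  ring

/-! ### Deformation by a Nijenhuis tensor. -/

section LieStructures

variable {R L : Type*} [CommRing R] [Algebra ℝ R] [AddCommGroup L] [Module R L]

namespace LieStructure

set_option linter.unusedSimpArgs false in
/-- `{𝒩~, μ}` is the function of the deformed structure. -/
theorem poisson_tilde_toFunction (hL : SeparatingForm (canonicalForm R L)) (μ ν : LieStructure R L)
    (N : L →ₗ[R] L) (hbracket : ∀ X Y, ν.bracket X Y = deformedBracket μ N X Y)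
    (hanchor : ∀ X, ν.anchor X = μ.anchor (N X)) :
    poisson (canonicalForm R L) (tilde (canonicalForm R L) (diagonalEndomorphism N))
      μ.toFunction = ν.toFunction := by
  have hs2 : (-1 : R) ^ 2 = 1 := by norm_num
  have hs3 : (-1 : R) ^ 3 = -1 := by norm_num
  have hs4 : (-1 : R) ^ 4 = 1 := by norm_num
  ext w
  by_cases hw : wordDegree w = 3
  swap
  · rw [ν.toFunction_supported w hw]
    exact bracketAt_eq_zero hL w (isRepresentable_tilde _ _) μ.isRepresentable_toFunction
      (isSupportedIn_tilde _ _) μ.isSupportedIn_toFunction (by norm_num; omega)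
  rcases wordDegree_eq_three hw with ⟨⟨X, ξ⟩, ⟨Y, η⟩, ⟨Z, ζ⟩, rfl⟩ | ⟨⟨X, ξ⟩, f, rfl⟩ |
    ⟨f, ⟨X, ξ⟩, rfl⟩
  · simp only [poisson, bracketAt, contract, parityFlip, wordDegree, zero_add, Nat.reduceAdd,
      hs2, hs3, hs4, pow_one, pow_zero, neg_mul, one_mul, neg_neg, mul_neg, sharp_tilde _ hL,
      μ.sharp_toFunction_section hL, μ.sharp_toFunction_function hL, μ.sharp_toFunction_neg hL,
      μ.sharp_toFunction_function_neg hL]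
    simp [toFunction, tilde, dorfman, differential, canonicalForm_apply, diagonalEndomorphism,
      hbracket, hanchor, deformedBracket, hL.sharp_zero]
    rw [μ.bracket_skew (N X) Y, μ.bracket_skew (N X) Z, μ.bracket_skew (N Y) Z]
    simp only [map_neg]
    ring
  · simp only [poisson, bracketAt, contract, parityFlip, wordDegree, zero_add, Nat.reduceAdd,
      hs2, hs3, hs4, pow_one, pow_zero, neg_mul, one_mul, neg_neg, mul_neg, sharp_tilde _ hL,
      μ.sharp_toFunction_section hL, μ.sharp_toFunction_function hL, μ.sharp_toFunction_neg hL,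
      μ.sharp_toFunction_function_neg hL]
    simp [toFunction, tilde, dorfman, differential, canonicalForm_apply, diagonalEndomorphism,
      hbracket, hanchor, deformedBracket, hL.sharp_zero]
  · simp only [poisson, bracketAt, contract, parityFlip, wordDegree, zero_add, Nat.reduceAdd,
      hs2, hs3, hs4, pow_one, pow_zero, neg_mul, one_mul, neg_neg, mul_neg, sharp_tilde _ hL,
      μ.sharp_toFunction_section hL, μ.sharp_toFunction_function hL, μ.sharp_toFunction_neg hL,
      μ.sharp_toFunction_function_neg hL]
    simp [toFunction, tilde, dorfman, differential, canonicalForm_apply, diagonalEndomorphism,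
      hbracket, hanchor, deformedBracket, hL.sharp_zero]

theorem _root_.CourantNijenhuis.IsNijenhuis.bracket_eq {μ : LieStructure R L} {N : L →ₗ[R] L}
    (hN : IsNijenhuis μ N) (X Y : L) : μ.bracket (N X) (N Y) =
      N (μ.bracket (N X) Y) + N (μ.bracket X (N Y)) - N (N (μ.bracket X Y)) := by
  rw [sub_eq_zero.1 (hN X Y), deformedBracket, map_sub, map_add]

/-- The structure deformed by a Nijenhuis tensor. -/
def deform (μ : LieStructure R L) (N : L →ₗ[R] L) (hN : IsNijenhuis μ N) : LieStructure R L where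
  bracket := AddMonoidHom.mk'
    (fun X => AddMonoidHom.mk' (deformedBracket μ N X) fun Y Z => by
      simp only [deformedBracket, map_add]; abel)
    fun X Y => by
      ext Z
      simp only [AddMonoidHom.mk'_apply, AddMonoidHom.add_apply, deformedBracket, map_add]; abel
  anchor := μ.anchor ∘ₗ N
  bracket_self X := by
    simp [deformedBracket, μ.bracket_self, μ.bracket_skew X (N X)]
  jacobi := by
    -- Using `N [Y, Z]_N = [N Y, N Z]`, the iterated deformed bracket becomes the iterated bracket
    -- with `N` in two slots, minus `N` of those with `N` in one slot, plus `N²` of the plain one.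
    have key : ∀ X Y Z, deformedBracket μ N X (deformedBracket μ N Y Z) =
        μ.bracket (N X) (μ.bracket (N Y) Z) + μ.bracket (N X) (μ.bracket Y (N Z))
          + μ.bracket X (μ.bracket (N Y) (N Z))
          - N (μ.bracket (N X) (μ.bracket Y Z) + μ.bracket X (μ.bracket (N Y) Z)
            + μ.bracket X (μ.bracket Y (N Z))) + N (N (μ.bracket X (μ.bracket Y Z))) := by
      intro X Y Z
      have h1 := hN.bracket_eq X (μ.bracket Y Z)
      have h2 : N (deformedBracket μ N Y Z) = μ.bracket (N Y) (N Z) :=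
        (sub_eq_zero.1 (hN Y Z)).symm
      rw [deformedBracket, h2]
      simp only [deformedBracket, map_add, map_sub, h1]
      abel
    have skew : ∀ X Y, deformedBracket μ N X Y = -deformedBracket μ N Y X := fun X Y => by
      simp only [deformedBracket, μ.bracket_skew (N Y) X, μ.bracket_skew Y (N X),
        μ.bracket_skew Y X, map_neg]
      abel
    have jac : ∀ X Y Z, μ.bracket X (μ.bracket Y Z) =
        μ.bracket Y (μ.bracket X Z) - μ.bracket Z (μ.bracket X Y) := fun X Y Z => by
      rw [μ.jacobi, μ.bracket_skew (μ.bracket X Y) Z]; abel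
    intro X Y Z
    simp only [AddMonoidHom.mk'_apply]
    -- One instance of Jacobi for `μ` for each placement of `N` in two, one or no slots.
    rw [skew (deformedBracket μ N X Y) Z, key, key, key, jac (N X) (N Y) Z, jac (N X) Y (N Z),
      jac X (N Y) (N Z), jac (N X) Y Z, jac X (N Y) Z, jac X Y (N Z), jac X Y Z]
    simp only [map_add, map_sub]
    abel
  leibniz X f Y := by
    simp only [AddMonoidHom.mk'_apply, deformedBracket, map_smul, leibniz, map_add,
      LinearMap.comp_apply, smul_add, smul_sub]
    abel
  anchor_bracket X Y f := by
    simp only [AddMonoidHom.mk'_apply, LinearMap.comp_apply, ← sub_eq_zero.1 (hN X Y),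
      anchor_bracket]

theorem deform_bracket (μ : LieStructure R L) (N : L →ₗ[R] L) (hN : IsNijenhuis μ N) (X Y : L) :
    (μ.deform N hN).bracket X Y = deformedBracket μ N X Y := rfl

theorem deform_anchor (μ : LieStructure R L) (N : L →ₗ[R] L) (hN : IsNijenhuis μ N) (X : L) :
    (μ.deform N hN).anchor X = μ.anchor (N X) := rfl

/-- Repeated use of `IsNijenhuis.bracket_eq` removes every bracket with `N` applied to both
arguments; the remaining terms cancel. -/
theorem _root_.CourantNijenhuis.IsNijenhuis.sq {μ : LieStructure R L} {N : L →ₗ[R] L}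
    (hN : IsNijenhuis μ N) : IsNijenhuis μ (N ∘ₗ N) := fun X Y => by
  simp only [deformedBracket, LinearMap.comp_apply, map_add, map_sub, hN.bracket_eq]
  abel

/-- Adding the identity does not change the torsion. This is what permits polarization in
`poisson_toFunction_deform`. -/
theorem _root_.CourantNijenhuis.IsNijenhuis.id_add {μ : LieStructure R L} {N : L →ₗ[R] L}
    (hN : IsNijenhuis μ N) : IsNijenhuis μ (LinearMap.id + N) := fun X Y => by
  simp only [deformedBracket, LinearMap.add_apply, LinearMap.id_apply, map_add, map_sub,
    AddMonoidHom.add_apply, hN.bracket_eq]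
  abel

/-- The structure deformed twice by `N` is the structure deformed by `N²`. -/
theorem deformedBracket_deform (μ : LieStructure R L) (N : L →ₗ[R] L) (hN : IsNijenhuis μ N)
    (X Y : L) : deformedBracket μ (N ∘ₗ N) X Y = deformedBracket (μ.deform N hN) N X Y := by
  simp only [deformedBracket, deform_bracket, LinearMap.comp_apply, map_add, map_sub,
    hN.bracket_eq]
  abel

/-- A structure is compatible with its deformations by Nijenhuis tensors. -/
theorem poisson_toFunction_deform (hL : SeparatingForm (canonicalForm R L)) (μ : LieStructure R L)
    (N : L →ₗ[R] L) (hN : IsNijenhuis μ N) :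
    poisson (canonicalForm R L) μ.toFunction (μ.deform N hN).toFunction = 0 := by
  -- The deformed bracket is linear in the endomorphism, and the identity deforms `μ` into itself.
  have hsum : (μ.deform _ hN.id_add).toFunction = μ.toFunction + (μ.deform N hN).toFunction := by
    ext w
    by_cases hw : wordDegree w = 3
    swap
    · simp [toFunction_supported _ _ hw]
    rcases wordDegree_eq_three hw with ⟨⟨X, ξ⟩, ⟨Y, η⟩, ⟨Z, ζ⟩, rfl⟩ | ⟨⟨X, ξ⟩, f, rfl⟩ |
      ⟨f, ⟨X, ξ⟩, rfl⟩ <;>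
      simp [toFunction, deform_bracket, deform_anchor, deformedBracket]
    ring
  have hμ := μ.isRepresentable_toFunction
  have hν := (μ.deform N hN).isRepresentable_toFunction
  have h := (μ.deform _ hN.id_add).poisson_toFunction_self hL
  rw [hsum, poisson_add_left hL hμ hν (hμ.add hν), poisson_add_right hL hμ hμ hν,
    poisson_add_right hL hν hμ hν, poisson_toFunction_self _ hL, poisson_toFunction_self _ hL,
    poisson_swap hL canonicalForm_symm hν hμ (isSupportedIn_toFunction _)
      (isSupportedIn_toFunction _), if_neg (by decide), zero_add, add_zero] at h
  -- Both degrees are `3`, so the bracket is symmetric here and the two cross terms add up; `2` is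
  -- invertible in an `ℝ`-algebra.
  have h2 : IsUnit (2 : R) := by
    have := (isUnit_iff_ne_zero.2 (two_ne_zero (α := ℝ))).map (algebraMap ℝ R)
    rwa [map_ofNat] at this
  ext w
  have hw : 2 * poisson (canonicalForm R L) μ.toFunction (μ.deform N hN).toFunction w = 0 := by
    rw [two_mul]; exact congrFun h w
  exact h2.mul_right_eq_zero.1 hw

/-- Here `{{𝒩~, μ}, 𝒩~} = -μ_{N²}`, and `μ` is compatible with `μ_{N²}` since `N²` is Nijenhuis. -/
theorem isWeakDeforming_of_isNijenhuis (hL : SeparatingForm (canonicalForm R L))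
    (μ : LieStructure R L) (N : L →ₗ[R] L) (hN : IsNijenhuis μ N) :
    IsWeakDeforming (canonicalForm R L) μ.toFunction (diagonalEndomorphism N) := by
  refine ⟨⟨μ.isOfDegree_toFunction, μ.poisson_toFunction_self hL⟩,
    isSkewEndomorphism_diagonal N, ?_⟩
  rw [poisson_tilde_toFunction hL μ (μ.deform N hN) N (fun _ _ => rfl) fun _ => rfl,
    poisson_swap hL canonicalForm_symm (isRepresentable_toFunction _) (isRepresentable_tilde _ _)
      (isSupportedIn_toFunction _) (isSupportedIn_tilde _ _), if_pos (by decide),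
    poisson_tilde_toFunction hL _ (μ.deform _ hN.sq) N (deformedBracket_deform μ N hN)
      fun _ => rfl,
    poisson_neg_right hL (isRepresentable_toFunction _) (isRepresentable_toFunction _),
    poisson_toFunction_deform hL, neg_zero]

theorem dualToFunction_trivial : (LieStructure.trivial R (Module.Dual R L)).dualToFunction = 0 := by
  ext w
  unfold dualToFunction
  split <;> simp [LieStructure.trivial]

theorem isLieBialgebroid_trivial (hL : SeparatingForm (canonicalForm R L)) (μ : LieStructure R L) :
    IsLieBialgebroid μ (LieStructure.trivial R (Module.Dual R L)) := by
  rw [IsLieBialgebroid, dualToFunction_trivial]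
  exact ⟨μ.poisson_toFunction_self hL, poisson_zero_right hL μ.isRepresentable_toFunction,
    poisson_zero_right hL .zero⟩

theorem double_trivial (μ : LieStructure R L) :
    double μ (LieStructure.trivial R (Module.Dual R L)) = μ.toFunction := by
  rw [double, dualToFunction_trivial, add_zero]

end LieStructure

end LieStructures

/-! ### Passage to vector bundles over a manifold. -/

section Geometry

variable {E : Type*} [NormedAddCommGroup E] [NormedSpace ℝ E]
  {H : Type*} [TopologicalSpace H] {I : ModelWithCorners ℝ E H}
  {M : Type*} [TopologicalSpace M] [ChartedSpace H M] [IsManifold I ∞ M]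
  {F : Type*} [NormedAddCommGroup F] [NormedSpace ℝ F]
  {A : M → Type*} [TopologicalSpace (Bundle.TotalSpace F A)]
  [∀ x, AddCommGroup (A x)] [∀ x, Module ℝ (A x)] [∀ x, TopologicalSpace (A x)]
  [FiberBundle F A] [VectorBundle ℝ F A]

/-- The sections of a vector bundle are separated by the linear forms over the smooth functions. -/
theorem section_eq_zero_of_dual_apply_eq_zero [FiniteDimensional ℝ E] [T2Space M]
    [ContMDiffVectorBundle ∞ F A I] (X : Cₛ^∞⟮I; F, A⟯)
    (hX : ∀ ξ : Module.Dual C^∞⟮I, M; ℝ⟯ Cₛ^∞⟮I; F, A⟯, ξ X = 0) : X = 0 := by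
  by_contra hne
  obtain ⟨x₀, hx₀⟩ : ∃ x, X x ≠ 0 := by
    by_contra! h
    exact hne (ContMDiffSection.ext h)
  let e := trivializationAt F A x₀
  have hmem : x₀ ∈ e.baseSet := FiberBundle.mem_baseSet_trivializationAt F A x₀
  have hne' : e.linearMapAt ℝ x₀ (X x₀) ≠ 0 := fun h => hx₀ <| by
    rw [← e.symmₗ_linearMapAt (R := ℝ) hmem (X x₀), h, map_zero]
  obtain ⟨l, hl⟩ := SeparatingDual.exists_ne_zero (R := ℝ) hne'
  -- The bump function is supported in the trivializing set, so the local form `l` extends by zero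
  -- to a global smooth form that still detects `X x₀`.
  obtain ⟨χ, -, hχ⟩ := (SmoothBumpFunction.nhds_basis_tsupport (I := I) x₀).mem_iff.1
    (e.open_baseSet.mem_nhds hmem)
  let ξ : Module.Dual C^∞⟮I, M; ℝ⟯ Cₛ^∞⟮I; F, A⟯ :=
    { toFun := fun s => ⟨fun x => χ x * l (e.linearMapAt ℝ x (s x)), by
        refine contMDiff_of_tsupport fun x hx => ?_
        have hxe : x ∈ e.baseSet := hχ (closure_mono (Function.support_mul_subset_left _ _) hx)
        have h1 : ContMDiffAt I 𝓘(ℝ, F) ∞ (fun y => (e ⟨y, s y⟩).2) x :=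
          (e.contMDiffAt_section_iff hxe).1 (s.contMDiff x)
        have h2 : ContMDiffAt I 𝓘(ℝ, F) ∞ (fun y => e.linearMapAt ℝ y (s y)) x :=
          h1.congr_of_eventuallyEq <| (e.open_baseSet.eventually_mem hxe).mono fun y hy => by
            simp only [e.coe_linearMapAt_of_mem hy]
        exact χ.contMDiffAt.mul (l.contMDiff.contMDiffAt.comp x h2)⟩
      map_add' := fun s t => by
        ext x
        change χ x * l (e.linearMapAt ℝ x (s x + t x)) =
          χ x * l (e.linearMapAt ℝ x (s x)) + χ x * l (e.linearMapAt ℝ x (t x))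
        rw [map_add, map_add, mul_add]
      map_smul' := fun f s => by
        ext x
        change χ x * l (e.linearMapAt ℝ x (f x • s x)) = f x * (χ x * l (e.linearMapAt ℝ x (s x)))
        rw [map_smul, map_smul, smul_eq_mul]
        ring }
  have h : χ x₀ * l (e.linearMapAt ℝ x₀ (X x₀)) = 0 := congrArg (fun f => f x₀) (hX ξ)
  rw [χ.eq_one, one_mul] at h
  exact hl h

/-- The composition of vector bundle morphisms. -/
def BundleMorphism.comp {F' : Type*} [NormedAddCommGroup F'] [NormedSpace ℝ F']
    {A' : M → Type*} [TopologicalSpace (Bundle.TotalSpace F' A')]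
    [∀ x, AddCommGroup (A' x)] [∀ x, Module ℝ (A' x)] [∀ x, TopologicalSpace (A' x)]
    [FiberBundle F' A'] [VectorBundle ℝ F' A'] (φ : BundleMorphism I F A F' A')
    (N : BundleMorphism I F A F A) : BundleMorphism I F A F' A' where
  toFun x := φ.toFun x ∘ₗ N.toFun x
  smooth s := φ.smooth (N.onSections s)

/-- The Lie algebroid deformed by a Nijenhuis tensor. -/
noncomputable def LieAlgebroid.deform (μ : LieAlgebroid I F A) (N : BundleMorphism I F A F A)
    (hN : IsNijenhuis μ.toLieStructure N.onSections) : LieAlgebroid I F A where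
  bracket := (μ.toLieStructure.deform _ hN).bracket
  -- On sections this composite agrees definitionally with the algebraic anchor, so the algebraic
  -- axioms transfer unchanged.
  anchor := μ.anchor.comp N
  bracket_self := (μ.toLieStructure.deform _ hN).bracket_self
  jacobi := (μ.toLieStructure.deform _ hN).jacobi
  leibniz := (μ.toLieStructure.deform _ hN).leibniz
  anchor_bracket := (μ.toLieStructure.deform _ hN).anchor_bracket

end Geometry

end CourantNijenhuis

theorem theorem4p6
    {E : Type*} [NormedAddCommGroup E] [NormedSpace ℝ E] [FiniteDimensional ℝ E]
    {H : Type*} [TopologicalSpace H] (I : ModelWithCorners ℝ E H) [I.Boundaryless]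
    {M : Type*} [TopologicalSpace M] [T2Space M] [SigmaCompactSpace M]
    [ChartedSpace H M] [IsManifold I ∞ M]
    (F : Type*) [NormedAddCommGroup F] [NormedSpace ℝ F] [FiniteDimensional ℝ F]
    (A : M → Type*) [TopologicalSpace (Bundle.TotalSpace F A)]
    [∀ x, AddCommGroup (A x)] [∀ x, Module ℝ (A x)] [∀ x, TopologicalSpace (A x)]
    [FiberBundle F A] [VectorBundle ℝ F A] [ContMDiffVectorBundle ∞ F A I]
    (μ : LieAlgebroid I F A) (N : BundleMorphism I F A F A)
    (hN : IsNijenhuis μ.toLieStructure N.onSections) :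
    IsWeakDeforming (canonicalForm C^∞⟮I, M; ℝ⟯ Cₛ^∞⟮I; F, A⟯)
        μ.toLieStructure.toFunction (diagonalEndomorphism N.onSections) ∧
      IsCourantStructure (canonicalForm C^∞⟮I, M; ℝ⟯ Cₛ^∞⟮I; F, A⟯)
        (poisson (canonicalForm C^∞⟮I, M; ℝ⟯ Cₛ^∞⟮I; F, A⟯)
          (tilde (canonicalForm C^∞⟮I, M; ℝ⟯ Cₛ^∞⟮I; F, A⟯) (diagonalEndomorphism N.onSections))
          μ.toLieStructure.toFunction) ∧
      ∃ μN : LieAlgebroid I F A,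
        (∀ X Y, μN.bracket X Y = deformedBracket μ.toLieStructure N.onSections X Y) ∧
        (∀ x, μN.anchor.toFun x = μ.anchor.toFun x ∘ₗ N.toFun x) ∧
        IsLieBialgebroid μN.toLieStructure
          (LieStructure.trivial C^∞⟮I, M; ℝ⟯ (Module.Dual C^∞⟮I, M; ℝ⟯ Cₛ^∞⟮I; F, A⟯)) ∧
        poisson (canonicalForm C^∞⟮I, M; ℝ⟯ Cₛ^∞⟮I; F, A⟯)
            (tilde (canonicalForm C^∞⟮I, M; ℝ⟯ Cₛ^∞⟮I; F, A⟯) (diagonalEndomorphism N.onSections))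
            μ.toLieStructure.toFunction =
          double μN.toLieStructure
            (LieStructure.trivial C^∞⟮I, M; ℝ⟯
              (Module.Dual C^∞⟮I, M; ℝ⟯ Cₛ^∞⟮I; F, A⟯)) := by

  have hL : SeparatingForm (canonicalForm C^∞⟮I, M; ℝ⟯ Cₛ^∞⟮I; F, A⟯) :=
    canonicalForm_separating section_eq_zero_of_dual_apply_eq_zero
  have h : poisson (canonicalForm C^∞⟮I, M; ℝ⟯ Cₛ^∞⟮I; F, A⟯)
      (tilde (canonicalForm C^∞⟮I, M; ℝ⟯ Cₛ^∞⟮I; F, A⟯) (diagonalEndomorphism N.onSections))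
      μ.toLieStructure.toFunction = (μ.deform N hN).toLieStructure.toFunction :=
    LieStructure.poisson_tilde_toFunction hL _ _ _ (fun _ _ => rfl) fun _ => rfl
  refine ⟨μ.toLieStructure.isWeakDeforming_of_isNijenhuis hL _ hN, ?_, μ.deform N hN,
    fun _ _ => rfl, fun _ => rfl, LieStructure.isLieBialgebroid_trivial hL _, ?_⟩
  · rw [h]
    exact ⟨LieStructure.isOfDegree_toFunction _, LieStructure.poisson_toFunction_self _ hL⟩
  · rw [h, LieStructure.double_trivial]
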